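/- An inversion sequence of length $n\ge 0$ is an integer sequence $e=(e_1,\dots,e_n)$ with $0\le e_j\le j-1$ for all $1\le j\le n$ (for $n=0$ there is exactly one, the empty sequence). The reduction of a word is obtained by replacing every occurrence of its $i$-th smallest distinct value by $i-1$. The sequence $e$ contains a pattern $w$ of length $k$ if there are indices $i_1<\dots<i_k$ such that the reduction of $e_{i_1}\cdots e_{i_k}$ is $w$; otherwise $e$ avoids $w$. Let $\mathcal{IS}_n^{(m)}(102,000)$ be the set of inversion sequences of length $n$ that avoid both $102$ and $000$ and have exactly $m$ distinct elements, i.e. $|\{e_1,\dots,e_n\}|=m$. For every integer $m\ge 0$, a $(102,000)$-avoiding inversion sequence with exactly $m$ distinct elements has length $n$ with $m\le n\le 2m$, and the number of all such sequences is $$\left|\bigcup_{n=m}^{2m}\mathcal{IS}_n^{(m)}(102,000)\right|=\frac{1}{2m+1}\binom{4m+2}{m}$$ (OEIS A069271). Moreover, there is exactly one formal power series $b=b(y)\in\mathbb{Q}[[y]]$ with $b=1+y\,b^4$, and $$\sum_{m\ge 0}\left|\bigcup_{n=m}^{2m}\mathcal{IS}_n^{(m)}(102,000)\right|y^m=b(y)^2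 .$$ -/

import Mathlib

namespace InvSeq

/-- `e = (e_1, ..., e_n)` is an inversion sequence of length `n = e.length`: `0 ≤ e_j ≤ j - 1` for
all `1 ≤ j ≤ n`. List positions start at `0`, so `e_j` is `e[j - 1]`. -/
def IsInversionSeq (e : List ℕ) : Prop :=
  ∀ (i : ℕ) (hi : i < e.length), e[i] ≤ i

/-- The reduction of a word: each entry `a` is replaced by the number of distinct values of the word
that are smaller than `a`, so that all copies of the `i`-th smallest value become `i - 1`. -/
def reduction (w : List ℕ) : List ℕ :=
  w.map fun a => (w.toFinset.filter fun b => b < a).card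

/-- `e` contains the pattern `w`: some subsequence `e_{i_1} ... e_{i_k}`, `i_1 < ... < i_k`, has
reduction `w`. (`List.Sublist` is the subsequence relation.) -/
def Contains (e w : List ℕ) : Prop :=
  ∃ s : List ℕ, s.Sublist e ∧ reduction s = w

/-- `e` avoids the pattern `w`. -/
def Avoids (e w : List ℕ) : Prop := ¬ Contains e w

/-- The set of inversion sequences of length `n` that avoid all the patterns in `ws`. -/
def IS (n : ℕ) (ws : List (List ℕ)) : Set (List ℕ) :=
  {e | e.length = n ∧ IsInversionSeq e ∧ ∀ w ∈ ws, Avoids e w}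

/-- The number of distinct elements of a sequence. -/
def dist (e : List ℕ) : ℕ := e.toFinset.card

/-- The set of inversion sequences of length `n` that avoid all the patterns in `ws` and have exactly
`m` distinct elements. -/
def ISdist (n m : ℕ) (ws : List (List ℕ)) : Set (List ℕ) :=
  {e | e ∈ IS n ws ∧ dist e = m}

end InvSeq

/-! Read a sequence from its large values downwards. Deleting the zeros of a word and lowering the
rest by one (`down`) preserves avoidance of 102 and 000, so the avoiding words form a generating
forest. A child of `f` is `up f` with zero, one or two zeros inserted. To avoid 102, a zero must go
into a cut where no entry on the right exceeds an entry on the left, i.e. into an element of `sites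
f`. Intermediate words need not be inversion sequences; `slack` measures by how much they fail.

How the tree continues from a nonempty `f` depends only on the slack `s` and the number `c` of
sites; the number `d` of distinct values merely shifts the count. If `b = 1 + X * b ^ 4`, the
descendants of `f` (itself included) of slack zero have generating function `X ^ (d + s) * b ^ (c +
3 * s + 2)`, which is `weight`. Two facts prove this. The weights satisfy the recursion of the tree
(`weight_eq_sum_kids`), by telescoping sums based on `X * b ^ 4 = b - 1`. The recursion also
determines each coefficient, since along every edge neither `d` nor `d + s` decreases and one of
them increases (`exists_finset_desc`).

Every nonempty avoiding word descends from `[0]` or `[0, 0]`, of weights `X * b ^ 4` and `X * b ^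
5`. With the empty word, the total is `1 + X * b ^ 4 + X * b ^ 5 = b ^ 2`. The closed formula
follows because the Raney numbers are the coefficients of the powers of `b`. -/

namespace InvSeq

open PowerSeries

/-! ### Raney numbers and the series `b = 1 + X * b ^ 4` -/

/-- The Fuss-Catalan (Raney) numbers `k / (4 j + k) * C(4 j + k, j)`. -/
def raney (j k : ℕ) : ℚ :=
  if j = 0 then 1 else k / (4 * j + k) * ((4 * j + k).choose j : ℚ)

theorem raney_zero_left (k : ℕ) : raney 0 k = 1 := by simp [raney]

theorem raney_succ_zero (j : ℕ) : raney (j + 1) 0 = 0 := by simp [raney]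

theorem raney_eq (j k : ℕ) : raney j (k + 1) =
    (k + 1) / (4 * j + (k + 1)) * ((4 * j + (k + 1)).choose j : ℚ) := by
  rcases j with _ | j
  · have : (k : ℚ) + 1 ≠ 0 := by positivity
    simp [raney, this]
  · simp [raney]

/-- Coefficient form of `b ^ (k + 1) = b ^ k + X * b ^ (k + 4)`. Both binomials with lower index `j
+ 1` are expressed through `(4 * j + k + 4).choose j`. -/
theorem raney_succ_succ (j k : ℕ) :
    raney (j + 1) (k + 1) = raney (j + 1) k + raney j (k + 4) := by
  rw [raney_eq j (k + 3)]
  simp only [raney, Nat.add_one_ne_zero, if_false]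
  have e1 : 4 * (j + 1) + (k + 1) = (4 * j + k + 4) + 1 := by ring
  have e2 : 4 * (j + 1) + k = 4 * j + k + 4 := by ring
  have e3 : 4 * j + (k + 3 + 1) = 4 * j + k + 4 := by ring
  rw [e1, e2, e3]
  have h1 := Nat.add_one_mul_choose_eq (4 * j + k + 4) j
  have h2 := Nat.choose_succ_right_eq (4 * j + k + 4) j
  have e4 : 4 * j + k + 4 - j = 3 * j + k + 4 := by omega
  rw [e4] at h2
  have h1' : (((4 * j + k + 4 + 1).choose (j + 1) : ℕ) : ℚ) =
      (4 * j + k + 4 + 1) * ((4 * j + k + 4).choose j : ℕ) / (j + 1) := by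
    rw [eq_div_iff (by positivity)]; exact_mod_cast h1.symm
  have h2' : (((4 * j + k + 4).choose (j + 1) : ℕ) : ℚ) =
      ((4 * j + k + 4).choose j : ℕ) * (3 * j + k + 4) / (j + 1) := by
    rw [eq_div_iff (by positivity)]; exact_mod_cast h2
  rw [h1', h2']
  push_cast
  have : (4 * (j + 1) + (k + 1) : ℚ) ≠ 0 := by positivity
  have : (4 * (j + 1) + k : ℚ) ≠ 0 := by positivity
  have : (4 * j + (k + 3 + 1) : ℚ) ≠ 0 := by positivity
  field_simp
  ring

/-- The generating function of `raney · k`. -/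
noncomputable def raneySeries (k : ℕ) : PowerSeries ℚ := PowerSeries.mk fun j => raney j k

theorem raneySeries_zero : raneySeries 0 = 1 := by
  ext j
  rcases j with _ | j <;> simp [raneySeries, raney_zero_left, raney_succ_zero, coeff_one]

theorem raneySeries_succ (k : ℕ) : raneySeries (k + 1) = raneySeries k + X * raneySeries (k + 4) := by
  ext j
  rcases j with _ | j <;>
    simp [raneySeries, raney_zero_left, raney_succ_succ, coeff_succ_X_mul]

/-- Both sides obey the recurrence `raneySeries_succ` in `k`. Its factor `X` lowers the degree, so
an outer induction on `n` and an inner one on `k` suffice. -/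
theorem coeff_raneySeries_mul (n k l : ℕ) :
    coeff n (raneySeries k * raneySeries l) = coeff n (raneySeries (k + l)) := by
  induction n generalizing k l with
  | zero =>
    rw [coeff_zero_eq_constantCoeff_apply, map_mul]
    simp only [← coeff_zero_eq_constantCoeff_apply, raneySeries, coeff_mk, raney_zero_left, mul_one]
  | succ n ih =>
    induction k with
    | zero => simp [raneySeries_zero]
    | succ k ihk =>
      rw [raneySeries_succ, add_mul, mul_assoc, map_add, ihk, coeff_succ_X_mul, ih,
        add_right_comm k 1 l, raneySeries_succ, map_add, coeff_succ_X_mul, add_right_comm]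

theorem raneySeries_eq_pow (k : ℕ) : raneySeries k = raneySeries 1 ^ k := by
  induction k with
  | zero => rw [raneySeries_zero, pow_zero]
  | succ k ih =>
    rw [pow_succ, ← ih]
    ext n
    rw [coeff_raneySeries_mul]

theorem raneySeries_one_eq : raneySeries 1 = 1 + X * raneySeries 1 ^ 4 := by
  rw [← raneySeries_eq_pow, ← raneySeries_zero, ← raneySeries_succ]

/-- The difference of the equations factors as `b - c` times a series with constant coefficient 1,
and power series over a field have no zero divisors. -/
theorem eq_of_eq_one_add_X_mul_pow_four {b c : PowerSeries ℚ} (hb : b = 1 + X * b ^ 4)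
    (hc : c = 1 + X * c ^ 4) : b = c := by
  have h : (b - c) * (1 - X * (b ^ 3 + b ^ 2 * c + b * c ^ 2 + c ^ 3)) = 0 := by
    linear_combination hb - hc
  rcases mul_eq_zero.1 h with h | h
  · exact sub_eq_zero.1 h
  · have := congrArg (constantCoeff (R := ℚ)) h
    simp at this

/-! ### Telescoping and summation by rank -/

/-- Telescopes, since `X * b ^ (i + e + 4) = b ^ (i + e + 1) - b ^ (i + e)`. -/
theorem sum_X_mul_pow {b : PowerSeries ℚ} (hb : b = 1 + X * b ^ 4) (n e : ℕ) :
    ∑ i ∈ Finset.range n, X * b ^ (i + e + 4) = b ^ (n + e) - b ^ e := by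
  induction n with
  | zero => simp
  | succ n ih =>
    rw [Finset.sum_range_succ, ih]
    linear_combination (-b ^ (n + e)) * hb

/-- The cardinality is the rank of `p` in `S`, and each rank from 1 to `S.card` occurs once. This
turns sums over sites into sums over an interval. -/
theorem sum_card_filter_le {R : Type*} [AddCommMonoid R] (S : Finset ℕ) (φ : ℕ → R) :
    ∑ p ∈ S, φ (S.filter (· ≤ p)).card = ∑ i ∈ Finset.range S.card, φ (i + 1) := by
  induction S using Finset.induction_on_max with
  | empty => simp
  | insert a T hT ih =>
    have ha : a ∉ T := fun h => lt_irrefl _ (hT a h)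
    rw [Finset.sum_insert ha, Finset.card_insert_of_notMem ha, Finset.sum_range_succ, ← ih, add_comm]
    congr 1
    · refine Finset.sum_congr rfl fun p hp => ?_
      rw [Finset.filter_insert, if_neg (not_le.2 (hT p hp))]
    · rw [Finset.filter_true_of_mem, Finset.card_insert_of_notMem ha]
      intro x hx
      rcases Finset.mem_insert.1 hx with rfl | hx
      · exact le_rfl
      · exact (hT x hx).le

/-! ### Words and the operation `down` -/

/-- Delete the zeros of a word and decrease all other entries by one. -/
def down : List ℕ → List ℕ
  | [] => []
  | 0 :: l => down l
  | (n + 1) :: l => n :: down l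

/-- The least `s` such that `e_j ≤ j - 1 + s` for all `j`. -/
def slack : List ℕ → ℕ
  | [] => 0
  | a :: l => max a (slack l - 1)

/-- `e` avoids `102` and `000`. -/
def Good (e : List ℕ) : Prop :=
  (∀ a b c, [a, b, c].Sublist e → b < a → c ≤ a) ∧ ∀ a, e.count a ≤ 2

/-- The cuts of `e` such that no entry to the right exceeds an entry to the left. -/
def sites (e : List ℕ) : Finset ℕ :=
  (Finset.range (e.length + 1)).filter fun p => ∀ x ∈ e.take p, ∀ z ∈ e.drop p, z ≤ x

/-- Insert a zero at position `p`. -/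
def ins (p : ℕ) (l : List ℕ) : List ℕ := l.take p ++ 0 :: l.drop p

/-- Increase all entries by one. -/
def up (f : List ℕ) : List ℕ := f.map Nat.succ

theorem down_append (u v : List ℕ) : down (u ++ v) = down u ++ down v := by
  induction u with
  | nil => rfl
  | cons a u ih => cases a <;> simp [down, ih]

theorem down_up (f : List ℕ) : down (up f) = f := by
  induction f with
  | nil => rfl
  | cons a u ih => simpa [up, down] using ih

theorem down_ins (p : ℕ) (l : List ℕ) : down (ins p l) = down l := by
  conv_rhs => rw [← List.take_append_drop p l]
  rw [ins, down_append, down_append, down]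

theorem up_down {e : List ℕ} (h : 0 ∉ e) : up (down e) = e := by
  induction e with
  | nil => rfl
  | cons a u ih =>
    cases a with
    | zero => simp at h
    | succ n => simpa [up, down] using ih (by simpa using h)

theorem zero_notMem_up (f : List ℕ) : 0 ∉ up f := by simp [up]

theorem up_down_sublist (e : List ℕ) : (up (down e)).Sublist e := by
  induction e with
  | nil => exact List.Sublist.refl _
  | cons a u ih =>
    cases a with
    | zero => exact ih.cons _
    | succ n => exact ih.cons_cons _

/-- `(up e).sum` is a measure that strictly drops under `down` on nonempty words; it excludes cycles
and gives termination. -/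
theorem sum_up_down_add_length_le (e : List ℕ) : (up (down e)).sum + e.length ≤ (up e).sum := by
  induction e with
  | nil => simp [up, down]
  | cons a u ih => cases a <;> simp [up, down] at ih ⊢ <;> omega

theorem sum_up_iterate_down_le (n : ℕ) (e : List ℕ) : (up (down^[n] e)).sum ≤ (up e).sum := by
  induction n generalizing e with
  | zero => exact le_rfl
  | succ n ih =>
    have := ih (down e)
    have := sum_up_down_add_length_le e
    rw [Function.iterate_succ_apply]
    omega

theorem iterate_down_ne_self {f : List ℕ} (hf : f ≠ []) (n : ℕ) : down^[n + 1] f ≠ f := by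
  intro h
  have h1 := sum_up_iterate_down_le n (down f)
  have h2 := sum_up_down_add_length_le f
  have h3 := List.length_pos_iff.2 hf
  rw [← Function.iterate_succ_apply, h] at h1
  omega

theorem iterate_down_injective {e f : List ℕ} (hf : f ≠ []) {t t' : ℕ} (h : down^[t] e = f)
    (h' : down^[t'] e = f) : t = t' := by
  wlog hlt : t < t' generalizing t t'
  · rcases lt_trichotomy t t' with h1 | h1 | h1
    · exact this h h' h1
    · exact h1
    · exact (this h' h h1).symm
  · obtain ⟨n, rfl⟩ := Nat.exists_eq_add_of_lt hlt
    rw [show t + n + 1 = (n + 1) + t by ring, Function.iterate_add_apply, h] at h'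
    exact absurd h' (iterate_down_ne_self hf n)

theorem iterate_down_nil (n : ℕ) : down^[n] [] = [] := by
  induction n with
  | zero => rfl
  | succ n ih => rw [Function.iterate_succ_apply]; exact ih

/-! ### Slack -/

theorem slack_le_iff (e : List ℕ) (s : ℕ) :
    slack e ≤ s ↔ ∀ (i : ℕ) (hi : i < e.length), e[i] ≤ i + s := by
  induction e generalizing s with
  | nil => simp [slack]
  | cons a l ih =>
    rw [slack, Nat.max_le, Nat.sub_le_iff_le_add, ih]
    constructor
    · rintro ⟨h1, h2⟩ i hi
      rcases i with _ | i
      · simpa using h1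
      · have := h2 i (by simpa using hi)
        simp only [List.getElem_cons_succ]
        omega
    · intro h
      refine ⟨by have := h 0 (by simp); rwa [List.getElem_cons_zero, Nat.zero_add] at this,
        fun i hi => ?_⟩
      have := h (i + 1) (by simpa using hi)
      simp only [List.getElem_cons_succ] at this
      omega

theorem isInversionSeq_iff (e : List ℕ) : IsInversionSeq e ↔ slack e = 0 := by
  rw [← Nat.le_zero, slack_le_iff]
  rfl

theorem slack_up {f : List ℕ} (hf : f ≠ []) : slack (up f) = slack f + 1 := by
  induction f with
  | nil => exact absurd rfl hf
  | cons a l ih =>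
    rcases l with _ | ⟨b, l⟩
    · simp [up, slack]
    · have := ih (by simp)
      simp only [up, List.map_cons] at this ⊢
      have hb : b ≤ slack (b :: l) := le_max_left _ _
      rw [slack, this, slack.eq_2 a]
      omega

theorem slack_append (u v : List ℕ) : slack (u ++ v) = max (slack u) (slack v - u.length) := by
  induction u with
  | nil => simp [slack]
  | cons a u ih =>
    rw [List.cons_append, slack, ih, slack, List.length_cons]
    omega

/-- The first entry of `u` already bounds every entry of `v`, so `v` never forces more slack. -/
theorem slack_append_of_forall_le {u v : List ℕ} (hu : u ≠ []) (h : ∀ x ∈ u, ∀ z ∈ v, z ≤ x) :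
    slack (u ++ v) = slack u := by
  rcases u with _ | ⟨a, u⟩
  · exact absurd rfl hu
  · have h1 : slack v ≤ a := (slack_le_iff v a).2 fun i hi =>
      (h a (by simp) _ (List.getElem_mem hi)).trans (Nat.le_add_left _ _)
    have h2 : a ≤ slack (a :: u) := le_max_left _ _
    rw [slack_append]
    omega

/-! ### Sites -/

theorem mem_sites {e : List ℕ} {p : ℕ} :
    p ∈ sites e ↔ p ≤ e.length ∧ ∀ x ∈ e.take p, ∀ z ∈ e.drop p, z ≤ x := by
  simp [sites]

theorem length_mem_sites_append {u v : List ℕ} :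
    u.length ∈ sites (u ++ v) ↔ ∀ x ∈ u, ∀ z ∈ v, z ≤ x := by
  simp [mem_sites]

theorem zero_mem_sites (e : List ℕ) : 0 ∈ sites e := by simp [mem_sites]

theorem length_mem_sites (e : List ℕ) : e.length ∈ sites e := by simp [mem_sites]

theorem le_length_of_mem_sites {e : List ℕ} {p : ℕ} (hp : p ∈ sites e) : p ≤ e.length :=
  (mem_sites.1 hp).1

theorem sites_up (f : List ℕ) : sites (up f) = sites f := by
  ext p
  simp [mem_sites, up, ← List.map_take, ← List.map_drop]

theorem length_ins {p : ℕ} {l : List ℕ} (hp : p ≤ l.length) : (ins p l).length = l.length + 1 := by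
  simp [ins]
  omega

theorem exists_append_of_le {p : ℕ} {l : List ℕ} (hp : p ≤ l.length) :
    ∃ u v, l = u ++ v ∧ u.length = p :=
  ⟨l.take p, l.drop p, (List.take_append_drop p l).symm, by simpa using hp⟩

theorem ins_append (u v : List ℕ) : ins u.length (u ++ v) = u ++ 0 :: v := by
  simp [ins]

theorem mem_sites_ins_of_le {g : List ℕ} {p r : ℕ} (hp : p ≤ g.length) (hr : r ≤ p) :
    r ∈ sites (ins p g) ↔ r ∈ sites g := by
  obtain ⟨u, v, rfl, rfl⟩ := exists_append_of_le hp
  obtain ⟨u₁, u₂, rfl, rfl⟩ := exists_append_of_le hr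
  rw [ins_append, List.append_assoc, List.append_assoc, length_mem_sites_append,
    length_mem_sites_append]
  simp only [List.mem_append, List.mem_cons]
  constructor
  · exact fun h x hx z hz => h x hx z (by tauto)
  · rintro h x hx z (hz | rfl | hz)
    · exact h x hx z (Or.inl hz)
    · exact Nat.zero_le _
    · exact h x hx z (Or.inr hz)

/-- A cut to the right of the new zero has that zero on its left, so everything after the cut must
vanish. Conversely, a zero tail is bounded by anything. -/
theorem mem_sites_ins_of_lt {g : List ℕ} {p r : ℕ} (hp : p ∈ sites g) (hr : p ≤ r)
    (hr' : r ≤ g.length) :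
    r + 1 ∈ sites (ins p g) ↔ ∀ z ∈ g.drop r, z = 0 := by
  obtain ⟨u, v, rfl, rfl⟩ := exists_append_of_le (le_length_of_mem_sites hp)
  rw [length_mem_sites_append] at hp
  obtain ⟨n, rfl⟩ := Nat.exists_eq_add_of_le hr
  rw [ins_append, mem_sites]
  simp only [List.length_append] at hr'
  have e1 : (u ++ 0 :: v).take (u.length + n + 1) = u ++ 0 :: v.take n := by
    rw [add_assoc, List.take_length_add_append, List.take_succ_cons]
  have e2 : (u ++ 0 :: v).drop (u.length + n + 1) = v.drop n := by
    rw [add_assoc, List.drop_length_add_append, List.drop_succ_cons]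
  have e3 : (u ++ v).drop (u.length + n) = v.drop n := by
    rw [List.drop_length_add_append]
  rw [e1, e2, e3]
  constructor
  · exact fun h z hz => Nat.le_zero.1 (h.2 0 (by simp) z hz)
  · refine fun h => ⟨by simp; omega, fun x hx z hz => ?_⟩
    rw [h z hz]
    exact Nat.zero_le _

theorem le_length_of_mem_sites_ins {g : List ℕ} {p r : ℕ} (hp : p ≤ g.length)
    (hr : r ∈ sites (ins p g)) : r ≤ g.length + 1 := by
  have := le_length_of_mem_sites hr
  rwa [length_ins hp] at this

theorem drop_eq_zero_iff {g : List ℕ} (hg : 0 ∉ g) {r : ℕ} (hr : r ≤ g.length) :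
    (∀ z ∈ g.drop r, z = 0) ↔ r = g.length := by
  constructor
  · intro h
    by_contra hne
    have hlt : r < g.length := lt_of_le_of_ne hr hne
    have h0 : g[r] = 0 := h _ (by rw [List.drop_eq_getElem_cons hlt]; exact List.mem_cons_self)
    exact hg (h0 ▸ List.getElem_mem hlt)
  · rintro rfl
    simp

/-- Cuts up to the new zero are unaffected. Beyond it only the final cut survives, because `g` has
no zeros. -/
theorem sites_ins {g : List ℕ} (hg : 0 ∉ g) {p : ℕ} (hp : p ∈ sites g) :
    sites (ins p g) = insert (g.length + 1) ((sites g).filter (· ≤ p)) := by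
  have hpl := le_length_of_mem_sites hp
  ext r
  rw [Finset.mem_insert, Finset.mem_filter]
  rcases le_or_gt r p with h | h
  · rw [mem_sites_ins_of_le hpl h]
    constructor
    · exact fun h' => Or.inr ⟨h', h⟩
    · rintro (rfl | h')
      · omega
      · exact h'.1
  · obtain ⟨r, rfl⟩ : ∃ n, r = n + 1 := ⟨r - 1, by omega⟩
    rcases le_or_gt r g.length with hr | hr
    · rw [mem_sites_ins_of_lt hp (by omega) hr, drop_eq_zero_iff hg hr]
      omega
    · constructor
      · intro h'
        have := le_length_of_mem_sites_ins hpl h'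
        omega
      · omega

theorem card_sites_ins {g : List ℕ} (hg : 0 ∉ g) {p : ℕ} (hp : p ∈ sites g) :
    (sites (ins p g)).card = ((sites g).filter (· ≤ p)).card + 1 := by
  rw [sites_ins hg hp, Finset.card_insert_of_notMem]
  intro h
  have := le_length_of_mem_sites (Finset.mem_filter.1 h).1
  omega

theorem drop_ins_eq_zero_iff {g : List ℕ} (hg : 0 ∉ g) {q r : ℕ} (hq : q ≤ g.length)
    (hr : r ≤ g.length) :
    (∀ z ∈ (ins q g).drop r, z = 0) ↔ r = g.length ∧ q = g.length := by
  constructor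
  · intro h
    rcases le_or_gt r q with hrq | hrq
    · obtain ⟨u, v, rfl, rfl⟩ := exists_append_of_le hq
      rw [ins_append, List.drop_append_of_le_length hrq] at h
      have hv : v = [] := by
        rcases v with _ | ⟨a, v⟩
        · rfl
        · exact absurd (h a (by simp)) (by rintro rfl; simp at hg)
      subst hv
      have := (drop_eq_zero_iff (g := u) (by simpa using hg) hrq).1
        (fun z hz => h z (List.mem_append_left _ hz))
      simp [this]
    · obtain ⟨r, rfl⟩ : ∃ n, r = n + 1 := ⟨r - 1, by omega⟩
      obtain ⟨u, v, rfl, rfl⟩ := exists_append_of_le hq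
      obtain ⟨n, rfl⟩ := Nat.exists_eq_add_of_le (Nat.lt_succ_iff.1 hrq)
      rw [ins_append, add_assoc, List.drop_length_add_append, List.drop_succ_cons] at h
      have := (drop_eq_zero_iff (g := v) (fun h' => hg (by simp [h']))
        (by simp at hr; omega)).1 h
      simp at hr
      omega
  · rintro ⟨rfl, rfl⟩
    simp [ins]

/-- As for one zero, the cuts up to `p` and the final cut remain. If the later zero ends the word,
the cut just before it is a further site. -/
theorem card_sites_ins_ins {g : List ℕ} (hg : 0 ∉ g) {p q : ℕ} (hp : p ∈ sites g)
    (hq : q ∈ sites g) (hpq : p ≤ q) :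
    (sites (ins p (ins q g))).card =
      ((sites g).filter (· ≤ p)).card + 1 + if q = g.length then 1 else 0 := by
  have hpl := le_length_of_mem_sites hp
  have hql := le_length_of_mem_sites hq
  have hp' : p ∈ sites (ins q g) := (mem_sites_ins_of_le hql hpq).2 hp
  have hpl' := le_length_of_mem_sites hp'
  have key : sites (ins p (ins q g)) =
      ((sites g).filter (· ≤ p)) ∪ (insert (g.length + 2) (if q = g.length then {g.length + 1} else ∅)) := by
    ext r
    rw [Finset.mem_union, Finset.mem_insert, Finset.mem_filter]
    have hif : r ∈ (if q = g.length then ({g.length + 1} : Finset ℕ) else ∅) ↔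
        q = g.length ∧ r = g.length + 1 := by
      split_ifs with h <;> simp [h]
    rw [hif]
    rcases le_or_gt r p with h | h
    · rw [mem_sites_ins_of_le hpl' h, mem_sites_ins_of_le hql (h.trans hpq)]
      constructor
      · exact fun h' => Or.inl ⟨h', h⟩
      · rintro (h' | rfl | h')
        · exact h'.1
        · omega
        · omega
    · obtain ⟨r, rfl⟩ : ∃ n, r = n + 1 := ⟨r - 1, by omega⟩
      rcases le_or_gt r g.length with hr | hr
      · rw [mem_sites_ins_of_lt hp' (by omega) (by rw [length_ins hql]; omega),
          drop_ins_eq_zero_iff hg hql hr]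
        omega
      · constructor
        · intro h'
          have := le_length_of_mem_sites_ins hpl' h'
          rw [length_ins hql] at this
          omega
        · intro h'
          obtain rfl : r = (ins q g).length := by rw [length_ins hql]; omega
          rw [mem_sites_ins_of_lt hp' hpl' le_rfl]
          simp
  rw [key, Finset.card_union_of_disjoint, Finset.card_insert_of_notMem, add_assoc, add_comm 1]
  · congr 1
    split_ifs <;> simp
  · split_ifs <;> simp
  · rw [Finset.disjoint_left]
    intro r hr hr'
    have := le_length_of_mem_sites (Finset.mem_filter.1 hr).1
    rw [Finset.mem_insert] at hr'
    split_ifs at hr' <;> simp at hr' <;> omega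

/-! ### Children of a word -/

theorem count_zero_ins (p : ℕ) (l : List ℕ) : (ins p l).count 0 = l.count 0 + 1 := by
  conv_rhs => rw [← List.take_append_drop p l]
  rw [ins, List.count_append, List.count_append, List.count_cons_self, add_assoc]

theorem count_ins_of_ne {a : ℕ} (ha : a ≠ 0) (p : ℕ) (l : List ℕ) :
    (ins p l).count a = l.count a := by
  conv_rhs => rw [← List.take_append_drop p l]
  rw [ins, List.count_append, List.count_append, List.count_cons_of_ne ha.symm]

theorem count_zero_up (f : List ℕ) : (up f).count 0 = 0 :=
  List.count_eq_zero.2 (zero_notMem_up f)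

theorem good_up {f : List ℕ} (hf : Good f) : Good (up f) := by
  refine ⟨fun a b c h hba => ?_, fun a => ?_⟩
  · obtain ⟨l, hl, he⟩ := List.sublist_map_iff.1 h
    rcases l with _ | ⟨a', _ | ⟨b', _ | ⟨c', _ | ⟨d', l⟩⟩⟩⟩ <;> simp at he
    obtain ⟨rfl, rfl, rfl⟩ := he
    exact Nat.succ_le_succ (hf.1 a' b' c' hl (Nat.lt_of_succ_lt_succ hba))
  · cases a with
    | zero => rw [count_zero_up]; omega
    | succ a => exact (List.count_map_of_injective f Nat.succ Nat.succ_injective a).trans_le (hf.2 a)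

theorem good_down {e : List ℕ} (he : Good e) : Good (down e) := by
  refine ⟨fun a b c h hba => ?_, fun a => ?_⟩
  · have := he.1 (a + 1) (b + 1) (c + 1) ((h.map Nat.succ).trans (up_down_sublist e)) (by omega)
    omega
  · rw [← List.count_map_of_injective (down e) Nat.succ Nat.succ_injective a]
    exact ((up_down_sublist e).count_le _).trans (he.2 _)

theorem good_iterate_down {e : List ℕ} (he : Good e) (n : ℕ) : Good (down^[n] e) := by
  induction n generalizing e with
  | zero => exact he
  | succ n ih => rw [Function.iterate_succ_apply]; exact ih (good_down he)

/-- A zero can only be the middle letter of a 102, and the site condition excludes exactly that. -/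
theorem good_ins {g : List ℕ} (hg : Good g) {p : ℕ} (hp : p ∈ sites g) (h0 : g.count 0 ≤ 1) :
    Good (ins p g) := by
  refine ⟨fun a b c h hba => ?_, fun a => ?_⟩
  · obtain ⟨u, v, rfl, rfl⟩ := exists_append_of_le (le_length_of_mem_sites hp)
    rw [length_mem_sites_append] at hp
    rw [ins_append] at h
    obtain ⟨l₁, l₂, he, h₁, h₂⟩ := List.sublist_append_iff.1 h
    rcases List.sublist_cons_iff.1 h₂ with h₂ | ⟨r, rfl, hr⟩
    · exact hg.1 a b c (he ▸ h₁.append h₂) hba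
    · rcases l₁ with _ | ⟨a', _ | ⟨b', _ | ⟨c', l₁⟩⟩⟩
      · simp at he; omega
      · simp at he
        obtain ⟨rfl, rfl, rfl⟩ := he
        exact hp a (h₁.subset (by simp)) c (hr.subset (by simp))
      · simp at he; omega
      · simp at he
  · by_cases ha : a = 0
    · subst ha; rw [count_zero_ins]; omega
    · rw [count_ins_of_ne ha]; exact hg.2 a

/-- The words `k` avoiding `102` and `000` such that `down k = f`. -/
def kids (f : List ℕ) : Finset (List ℕ) :=
  {up f} ∪ ((sites f).image fun p => ins p (up f)) ∪
    ((sites f).sigma fun q => (sites f).filter (· ≤ q)).image fun x => ins x.2 (ins x.1 (up f))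

theorem mem_kids {f k : List ℕ} : k ∈ kids f ↔ k = up f ∨ (∃ p ∈ sites f, k = ins p (up f)) ∨
    ∃ q ∈ sites f, ∃ p ∈ sites f, p ≤ q ∧ k = ins p (ins q (up f)) := by
  simp only [kids, Finset.mem_union, Finset.mem_singleton, Finset.mem_image, Finset.mem_sigma,
    Finset.mem_filter, or_assoc]
  refine or_congr Iff.rfl (or_congr ?_ ?_)
  · simp only [eq_comm]
  · constructor
    · rintro ⟨⟨q, p⟩, ⟨hq, hp, hpq⟩, rfl⟩
      exact ⟨q, hq, p, hp, hpq, rfl⟩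
    · rintro ⟨q, hq, p, hp, hpq, rfl⟩
      exact ⟨⟨q, p⟩, ⟨hq, hp, hpq⟩, rfl⟩

theorem mem_sites_ins_up {f : List ℕ} {p q : ℕ} (hp : p ∈ sites f) (hq : q ∈ sites f)
    (hpq : p ≤ q) : p ∈ sites (ins q (up f)) := by
  rw [← sites_up] at hp hq
  exact (mem_sites_ins_of_le (le_length_of_mem_sites hq) hpq).2 hp

theorem down_of_mem_kids {f k : List ℕ} (hk : k ∈ kids f) : down k = f := by
  rcases mem_kids.1 hk with rfl | ⟨p, -, rfl⟩ | ⟨q, -, p, -, -, rfl⟩ <;>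
    simp only [down_ins, down_up]

theorem good_of_mem_kids {f k : List ℕ} (hf : Good f) (hk : k ∈ kids f) : Good k := by
  rcases mem_kids.1 hk with rfl | ⟨p, hp, rfl⟩ | ⟨q, hq, p, hp, hpq, rfl⟩
  · exact good_up hf
  · exact good_ins (good_up hf) (by rwa [sites_up]) (by rw [count_zero_up]; omega)
  · refine good_ins (good_ins (good_up hf) (by rwa [sites_up]) (by rw [count_zero_up]; omega))
      (mem_sites_ins_up hp hq hpq) ?_
    rw [count_zero_ins, count_zero_up]

theorem ne_nil_of_mem_kids {f k : List ℕ} (hf : f ≠ []) (hk : k ∈ kids f) : k ≠ [] := by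
  rintro rfl
  exact hf (down_of_mem_kids hk).symm

theorem pos_of_mem_of_zero_notMem {u : List ℕ} (hu : 0 ∉ u) {x : ℕ} (hx : x ∈ u) : 0 < x :=
  Nat.pos_of_ne_zero (by rintro rfl; exact hu hx)

theorem forall_le_of_good {u v : List ℕ} (hu : 0 ∉ u) (h : Good (u ++ 0 :: v)) :
    ∀ x ∈ u, ∀ z ∈ v, z ≤ x := fun x hx z hz =>
  h.1 x 0 z (List.Sublist.append (List.singleton_sublist.2 hx)
    ((List.singleton_sublist.2 hz).cons_cons 0)) (pos_of_mem_of_zero_notMem hu hx)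

/-- Cutting at the first and, if present, second zero recovers the insertion positions. Avoidance of
102 makes them sites, and avoidance of 000 excludes a third zero. -/
theorem mem_kids_down {e : List ℕ} (he : Good e) : e ∈ kids (down e) := by
  rw [mem_kids]
  by_cases h0 : 0 ∈ e
  · obtain ⟨u, v, rfl, hu⟩ := List.eq_append_cons_of_mem h0
    have huv := forall_le_of_good hu he
    have hd : down (u ++ 0 :: v) = down (u ++ v) := by simp [down_append, down]
    rw [hd, ← ins_append u v]
    by_cases h0' : 0 ∈ v
    · obtain ⟨v, w, rfl, hv⟩ := List.eq_append_cons_of_mem h0'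
      have hw : 0 ∉ w := by
        have := he.2 0
        simp only [List.count_append, List.count_cons_self] at this
        exact List.count_eq_zero.1 (by omega)
      -- Without the first zero, the second is preceded by nonzero letters only, so
      -- `forall_le_of_good` applies to it as well.
      have hg : Good ((u ++ v) ++ 0 :: w) := by
        refine ⟨fun a b c h => he.1 a b c (h.trans ?_), fun a => ?_⟩
        · rw [List.append_assoc]
          exact List.Sublist.append (List.Sublist.refl _) (List.sublist_cons_self _ _)
        · refine (List.Sublist.count_le a ?_).trans (he.2 a)
          rw [List.append_assoc]
          exact List.Sublist.append (List.Sublist.refl _) (List.sublist_cons_self _ _)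
      have hvw := forall_le_of_good (by simp [hu, hv]) hg
      have hd' : down (u ++ (v ++ 0 :: w)) = down (u ++ v ++ w) := by simp [down_append, down]
      have hq : (u ++ v).length ∈ sites (u ++ v ++ w) := length_mem_sites_append.2 hvw
      have hp : u.length ∈ sites (u ++ v ++ w) := by
        rw [List.append_assoc, length_mem_sites_append]
        exact fun x hx z hz => huv x hx z (by simp at hz ⊢; tauto)
      have hup : up (down (u ++ v ++ w)) = u ++ v ++ w := up_down (by simp [hu, hv, hw])
      refine Or.inr (Or.inr ⟨(u ++ v).length, ?_, u.length, ?_, by simp, ?_⟩)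
      · rwa [hd', ← sites_up, hup]
      · rwa [hd', ← sites_up, hup]
      · rw [hd', hup, ins_append (u ++ v) w, List.append_assoc]
    · have hup : up (down (u ++ v)) = u ++ v := up_down (by simp [hu, h0'])
      refine Or.inr (Or.inl ⟨u.length, ?_, ?_⟩)
      · rwa [← sites_up, hup, length_mem_sites_append]
      · rw [hup]
  · exact Or.inl (up_down h0).symm

/-- The inserted zero is the first zero of the result, so its index recovers `p`. -/
theorem ins_injective {l l' : List ℕ} {p p' : ℕ} (hp : p ≤ l.length) (hp' : p' ≤ l'.length)
    (h0 : 0 ∉ l.take p) (h0' : 0 ∉ l'.take p') (h : ins p l = ins p' l') : p = p' ∧ l = l' := by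
  obtain ⟨u, v, rfl, rfl⟩ := exists_append_of_le hp
  obtain ⟨u', v', rfl, rfl⟩ := exists_append_of_le hp'
  rw [List.take_left] at h0 h0'
  rw [ins_append, ins_append] at h
  have h1 := congrArg (List.idxOf 0) h
  rw [List.idxOf_append_of_notMem h0, List.idxOf_append_of_notMem h0', List.idxOf_cons_self,
    List.idxOf_cons_self] at h1
  have h2 := List.append_inj h h1
  simp only [List.cons.injEq, true_and] at h2
  exact ⟨h1, by rw [h2.1, h2.2]⟩

/-- No child is produced twice: the number of zeros separates the three families, and within a
family the positions can be read off, as the zero at `p ≤ q` is leftmost. -/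
theorem sum_kids {R : Type*} [AddCommMonoid R] (f : List ℕ) (w : List ℕ → R) :
    ∑ k ∈ kids f, w k = w (up f) + ∑ p ∈ sites f, w (ins p (up f)) +
      ∑ q ∈ sites f, ∑ p ∈ (sites f).filter (· ≤ q), w (ins p (ins q (up f))) := by
  have h0 := count_zero_up f
  have hs : ∀ p ∈ sites f, p ≤ (up f).length := fun p hp =>
    le_length_of_mem_sites (by rwa [sites_up])
  have ht : ∀ p, 0 ∉ (up f).take p := fun p h => zero_notMem_up f (List.mem_of_mem_take h)
  have ht' : ∀ p q, q ∈ sites f → p ≤ q → 0 ∉ (ins q (up f)).take p := by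
    intro p q hq h
    rw [ins, List.take_append_of_le_length (by have := hs q hq; simp; omega), List.take_take]
    exact ht _
  rw [kids, Finset.sum_union, Finset.sum_union, Finset.sum_singleton, Finset.sum_image,
    Finset.sum_image, Finset.sum_sigma]
  · rintro ⟨q, p⟩ h ⟨q', p'⟩ h' he
    simp only [Finset.coe_sigma, Set.mem_sigma_iff, Finset.mem_coe, Finset.mem_filter] at h h'
    have hl := length_ins (hs q h.1)
    have hl' := length_ins (hs q' h'.1)
    have := hs p h.2.1
    have := hs p' h'.2.1
    obtain ⟨rfl, h1⟩ := ins_injective (by omega) (by omega) (ht' p q h.1 h.2.2)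
      (ht' p' q' h'.1 h'.2.2) he
    obtain ⟨rfl, -⟩ := ins_injective (hs q h.1) (hs q' h'.1) (ht _) (ht _) h1
    rfl
  · exact fun p hp p' hp' he => (ins_injective (hs p hp) (hs p' hp') (ht _) (ht _) he).1
  · rw [Finset.disjoint_left]
    intro k hk hk'
    rw [Finset.mem_singleton] at hk
    obtain ⟨p, -, rfl⟩ := Finset.mem_image.1 hk'
    have := count_zero_ins p (up f)
    rw [hk] at this
    omega
  · rw [Finset.disjoint_left]
    intro k hk hk'
    obtain ⟨x, -, rfl⟩ := Finset.mem_image.1 hk'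
    have h1 := count_zero_ins x.2 (ins x.1 (up f))
    have h3 := count_zero_ins x.1 (up f)
    rcases Finset.mem_union.1 hk with hk | hk
    · rw [Finset.mem_singleton] at hk
      rw [hk] at h1
      omega
    · obtain ⟨p, -, hk⟩ := Finset.mem_image.1 hk
      have h2 := count_zero_ins p (up f)
      rw [hk] at h2
      omega

/-! ### Statistics of the children -/

theorem dist_up (f : List ℕ) : dist (up f) = dist f := by
  have : (up f).toFinset = f.toFinset.image Nat.succ := by ext; simp [up]
  rw [dist, this, Finset.card_image_of_injective _ Nat.succ_injective, dist]

theorem toFinset_ins (p : ℕ) (l : List ℕ) : (ins p l).toFinset = insert 0 l.toFinset := by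
  conv_rhs => rw [← List.take_append_drop p l]
  ext x
  simp only [ins, List.mem_toFinset, List.mem_append, List.mem_cons, Finset.mem_insert]
  tauto

theorem dist_ins_up (p : ℕ) (f : List ℕ) : dist (ins p (up f)) = dist f + 1 := by
  rw [dist, toFinset_ins, Finset.card_insert_of_notMem (by simpa using zero_notMem_up f),
    ← dist_up f, dist]

theorem dist_ins_ins_up (p q : ℕ) (f : List ℕ) : dist (ins p (ins q (up f))) = dist f + 1 := by
  rw [← dist_ins_up q f, dist, toFinset_ins, toFinset_ins, Finset.insert_idem, ← toFinset_ins, dist]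

theorem slack_ins_zero (l : List ℕ) : slack (ins 0 l) = slack l - 1 := by
  simp [ins, slack]

/-- The nonempty part before the zero dominates everything after it and alone determines the slack,
so shifting the rest is harmless. -/
theorem slack_ins_of_pos {l : List ℕ} {p : ℕ} (hp : p ∈ sites l) (h0 : p ≠ 0) :
    slack (ins p l) = slack l := by
  obtain ⟨u, v, rfl, rfl⟩ := exists_append_of_le (le_length_of_mem_sites hp)
  rw [length_mem_sites_append] at hp
  have hu : u ≠ [] := by rintro rfl; simp at h0
  rw [ins_append, slack_append_of_forall_le hu hp, slack_append_of_forall_le hu]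
  intro x hx z hz
  rcases List.mem_cons.1 hz with rfl | hz
  · exact Nat.zero_le _
  · exact hp x hx z hz

theorem slack_ins_up {f : List ℕ} (hf : f ≠ []) {p : ℕ} (hp : p ∈ sites f) :
    slack (ins p (up f)) = if p = 0 then slack f else slack f + 1 := by
  split_ifs with h
  · rw [h, slack_ins_zero, slack_up hf, Nat.add_sub_cancel]
  · rw [slack_ins_of_pos (by rwa [sites_up]) h, slack_up hf]

theorem slack_ins_ins_up {f : List ℕ} (hf : f ≠ []) {p q : ℕ} (hp : p ∈ sites f)
    (hq : q ∈ sites f) (hpq : p ≤ q) : slack (ins p (ins q (up f))) =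
      if q = 0 then slack f - 1 else if p = 0 then slack f else slack f + 1 := by
  split_ifs with h h'
  · obtain rfl : p = 0 := by omega
    rw [slack_ins_zero, slack_ins_up hf hq, if_pos h]
  · rw [h', slack_ins_zero, slack_ins_up hf hq, if_neg h, Nat.add_sub_cancel]
  · rw [slack_ins_of_pos (mem_sites_ins_up hp hq hpq) h', slack_ins_up hf hq, if_neg h]

theorem length_up (f : List ℕ) : (up f).length = f.length := by simp [up]

theorem card_sites_ins_up {f : List ℕ} {p : ℕ} (hp : p ∈ sites f) :
    (sites (ins p (up f))).card = ((sites f).filter (· ≤ p)).card + 1 := by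
  rw [card_sites_ins (zero_notMem_up f) (by rwa [sites_up]), sites_up]

theorem card_sites_ins_ins_up {f : List ℕ} {p q : ℕ} (hp : p ∈ sites f)
    (hq : q ∈ sites f) (hpq : p ≤ q) : (sites (ins p (ins q (up f)))).card =
      ((sites f).filter (· ≤ p)).card + 1 + if q = f.length then 1 else 0 := by
  rw [card_sites_ins_ins (zero_notMem_up f) (by rwa [sites_up]) (by rwa [sites_up]) hpq, sites_up,
    length_up]

theorem card_sites_eq {f : List ℕ} (hf : f ≠ []) : ∃ n, (sites f).card = n + 2 := by
  have h : ({0, f.length} : Finset ℕ) ⊆ sites f := by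
    intro p hp
    simp only [Finset.mem_insert, Finset.mem_singleton] at hp
    rcases hp with rfl | rfl
    · exact zero_mem_sites f
    · exact length_mem_sites f
  have h1 := Finset.card_le_card h
  have h2 : 0 ≠ f.length := (List.length_pos_iff.2 hf).ne
  rw [Finset.card_pair h2] at h1
  exact ⟨_, (Nat.sub_add_cancel h1).symm⟩

theorem card_filter_le_eq_one_iff {f : List ℕ} {p : ℕ} (hp : p ∈ sites f) :
    ((sites f).filter (· ≤ p)).card = 1 ↔ p = 0 := by
  constructor
  · intro h
    obtain ⟨a, ha⟩ := Finset.card_eq_one.1 h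
    have h1 : p ∈ (sites f).filter (· ≤ p) := by simp [hp]
    have h2 : 0 ∈ (sites f).filter (· ≤ p) := by simp [zero_mem_sites]
    rw [ha, Finset.mem_singleton] at h1 h2
    rw [h1, h2]
  · rintro rfl
    rw [Finset.card_eq_one]
    refine ⟨0, ?_⟩
    ext r
    simp only [Finset.mem_filter, Finset.mem_singleton]
    constructor
    · rintro ⟨-, h⟩; omega
    · rintro rfl; exact ⟨zero_mem_sites f, le_rfl⟩

theorem card_filter_le_eq_card_iff {f : List ℕ} {p : ℕ} (hp : p ∈ sites f) :
    ((sites f).filter (· ≤ p)).card = (sites f).card ↔ p = f.length := by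
  rw [Finset.card_filter_eq_iff]
  constructor
  · intro h
    exact le_antisymm (le_length_of_mem_sites hp) (h _ (length_mem_sites f))
  · rintro rfl x hx
    exact le_length_of_mem_sites hx

/-! ### Weights -/

/-- The generating function, by number of distinct entries, of the inversion sequences `e` avoiding
`102` and `000` such that `f` is the word of the large entries of `e`. -/
noncomputable def weight (b : PowerSeries ℚ) (f : List ℕ) : PowerSeries ℚ :=
  X ^ (dist f + slack f) * b ^ ((sites f).card + 3 * slack f + 2)

/-- Sums the weights over the position of the leftmost zero. The term `p = 0`, where slack is one
less, is the lower boundary term of the telescoping sum over the other positions. `ε` is the extra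
site created when a second zero ends the word. -/
theorem sum_weight_ins {b : PowerSeries ℚ} (hb : b = 1 + X * b ^ 4) {f : List ℕ}
    {q : ℕ} (hq : q ∈ sites f) (ε : ℕ) :
    ∑ p ∈ (sites f).filter (· ≤ q), X ^ (dist f + 1 + if p = 0 then slack f else slack f + 1) *
      b ^ (((sites f).filter (· ≤ p)).card + 1 + ε +
        3 * (if p = 0 then slack f else slack f + 1) + 2) =
    X ^ (dist f + slack f + 1) *
      b ^ (((sites f).filter (· ≤ q)).card + 3 * slack f + 3 + ε) := by
  set S := (sites f).filter (· ≤ q)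
  obtain ⟨φ, hφ⟩ : ∃ φ : ℕ → PowerSeries ℚ, φ = fun i =>
      X ^ (dist f + 1 + if i = 1 then slack f else slack f + 1) *
        b ^ (i + 1 + ε + 3 * (if i = 1 then slack f else slack f + 1) + 2) := ⟨_, rfl⟩
  have h1 : ∀ p ∈ S, X ^ (dist f + 1 + if p = 0 then slack f else slack f + 1) *
      b ^ (((sites f).filter (· ≤ p)).card + 1 + ε +
        3 * (if p = 0 then slack f else slack f + 1) + 2) =
      φ (S.filter (· ≤ p)).card := by
    intro p hp
    have hp' := Finset.mem_filter.1 hp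
    have e : S.filter (· ≤ p) = (sites f).filter (· ≤ p) := by
      ext r
      simp only [S, Finset.mem_filter, and_assoc]
      exact and_congr_right fun _ => ⟨fun h => h.2, fun h => ⟨h.trans hp'.2, h⟩⟩
    rw [e, hφ]
    simp only [card_filter_le_eq_one_iff hp'.1]
  rw [Finset.sum_congr rfl h1, sum_card_filter_le]
  obtain ⟨n, hn⟩ : ∃ n, S.card = n + 1 := by
    refine ⟨S.card - 1, (Nat.sub_add_cancel (Finset.card_pos.2 ⟨q, ?_⟩)).symm⟩
    simp [S, hq]
  rw [hn, Finset.sum_range_succ']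
  have h2 : ∀ i ∈ Finset.range n,
      X ^ (dist f + 1 + if i + 1 + 1 = 1 then slack f else slack f + 1) *
      b ^ (i + 1 + 1 + 1 + ε + 3 * (if i + 1 + 1 = 1 then slack f else slack f + 1) + 2) =
      X ^ (dist f + slack f + 1) * (X * b ^ (i + (3 * slack f + 4 + ε) + 4)) := by
    intro i _
    rw [if_neg (by omega)]
    ring
  simp only [hφ]
  rw [Finset.sum_congr rfl h2, ← Finset.mul_sum, sum_X_mul_pow hb]
  simp only [zero_add, if_true]
  ring

/-- The closed form satisfies the recursion of the tree. The exceptional summand counts `f` itself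
when it is an inversion sequence. -/
theorem weight_eq_sum_kids {b : PowerSeries ℚ} (hb : b = 1 + X * b ^ 4) {f : List ℕ}
    (hf : f ≠ []) :
    weight b f = (if slack f = 0 then X ^ dist f else 0) + ∑ k ∈ kids f, weight b k := by
  obtain ⟨n, hn⟩ := card_sites_eq hf
  have hlen : f.length ≠ 0 := (List.length_pos_iff.2 hf).ne'
  have h1 : ∑ p ∈ sites f, weight b (ins p (up f)) =
      X ^ (dist f + slack f + 1) * b ^ (n + 3 * slack f + 5) := by
    have e := sum_weight_ins hb (length_mem_sites f) 0
    have hS : (sites f).filter (· ≤ f.length) = sites f :=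
      Finset.filter_true_of_mem fun p hp => le_length_of_mem_sites hp
    rw [hS, hn] at e
    rw [show n + 3 * slack f + 5 = n + 2 + 3 * slack f + 3 + 0 by ring, ← e]
    refine Finset.sum_congr rfl fun p hp => ?_
    rw [weight, dist_ins_up, slack_ins_up hf hp, card_sites_ins_up hp, add_zero]
  -- `i` is the rank of `q` among the sites: rank 1 means both zeros are in front, and rank `n + 2`
  -- means the second zero ends the word and adds a site.
  obtain ⟨φ, hφ⟩ : ∃ φ : ℕ → PowerSeries ℚ, φ = fun i =>
      if i = 1 then X ^ (dist f + 1 + (slack f - 1)) * b ^ (3 * (slack f - 1) + 4) else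
        X ^ (dist f + slack f + 1) * b ^ (i + 3 * slack f + 3 + if i = n + 2 then 1 else 0) :=
    ⟨_, rfl⟩
  have h2 : ∀ q ∈ sites f, ∑ p ∈ (sites f).filter (· ≤ q), weight b (ins p (ins q (up f))) =
      φ ((sites f).filter (· ≤ q)).card := by
    intro q hq
    simp only [hφ, card_filter_le_eq_one_iff hq, ← hn, card_filter_le_eq_card_iff hq]
    split_ifs with h0 h3
    · subst h0
      have hS : (sites f).filter (· ≤ 0) = {0} := by
        ext r
        simp only [Finset.mem_filter, Finset.mem_singleton]
        constructor
        · rintro ⟨-, h⟩; omega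
        · rintro rfl; exact ⟨zero_mem_sites f, le_rfl⟩
      rw [hS, Finset.sum_singleton, weight, dist_ins_ins_up, slack_ins_ins_up hf hq hq le_rfl,
        card_sites_ins_ins_up hq hq le_rfl, hS, if_pos rfl, if_neg (Ne.symm hlen),
        Finset.card_singleton]
      ring
    · rw [← sum_weight_ins hb hq]
      refine Finset.sum_congr rfl fun p hp => ?_
      obtain ⟨hp, hpq⟩ := Finset.mem_filter.1 hp
      rw [weight, dist_ins_ins_up, slack_ins_ins_up hf hp hq hpq,
        card_sites_ins_ins_up hp hq hpq, if_neg h0, if_pos h3]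
    · rw [← sum_weight_ins hb hq]
      refine Finset.sum_congr rfl fun p hp => ?_
      obtain ⟨hp, hpq⟩ := Finset.mem_filter.1 hp
      rw [weight, dist_ins_ins_up, slack_ins_ins_up hf hp hq hpq,
        card_sites_ins_ins_up hp hq hpq, if_neg h0, if_neg h3]
  have h3 : weight b (up f) = X ^ (dist f + slack f + 1) * b ^ (n + 3 * slack f + 7) := by
    rw [weight, dist_up, slack_up hf, sites_up, hn]
    ring
  rw [sum_kids, h1, h3, Finset.sum_congr rfl h2, sum_card_filter_le, hn, Finset.sum_range_succ,
    Finset.sum_range_succ', hφ]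
  have h4 : ∀ i ∈ Finset.range n, (if i + 1 + 1 = 1 then
      X ^ (dist f + 1 + (slack f - 1)) * b ^ (3 * (slack f - 1) + 4) else
        X ^ (dist f + slack f + 1) *
          b ^ (i + 1 + 1 + 3 * slack f + 3 + if i + 1 + 1 = n + 2 then 1 else 0)) =
      X ^ (dist f + slack f) * (X * b ^ (i + (3 * slack f + 1) + 4)) := by
    intro i hi
    have := Finset.mem_range.1 hi
    rw [if_neg (by omega), if_neg (by omega)]
    ring
  simp only
  rw [Finset.sum_congr rfl h4, ← Finset.mul_sum, sum_X_mul_pow hb,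
    if_neg (show ¬n + 1 + 1 = 1 by omega), if_pos trivial, if_pos trivial,
    weight, hn]
  -- The one-zero children, the case where `q` is last, and `up f` contribute three consecutive
  -- powers of `b`, with exponents `n + 3 * slack f + 5` to `+ 7`, which telescope.
  have h5 := sum_X_mul_pow hb 3 (n + 3 * slack f + 1)
  simp only [Finset.sum_range_succ, Finset.sum_range_zero] at h5
  rcases Nat.eq_zero_or_pos (slack f) with hs | hs
  -- Two zeros in front cannot lower slack 0. Their term `X ^ (dist f + 1) * b ^ 4` and the summand
  -- for `f` itself add up to `X ^ dist f * b`, which is what the general case needs.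
  · rw [hs] at h5 ⊢
    simp only [if_true, Nat.zero_sub, mul_zero, add_zero, zero_add] at h5 ⊢
    linear_combination X ^ dist f * hb - X ^ dist f * h5
  · obtain ⟨s, hs⟩ : ∃ s, slack f = s + 1 := ⟨slack f - 1, by omega⟩
    rw [hs] at h5 ⊢
    rw [if_neg (by omega), Nat.add_sub_cancel]
    linear_combination (-X ^ (dist f + s + 1)) * h5

/-! ### Counting descendants -/

/-- The `(102, 000)`-avoiding inversion sequences with `M` distinct entries from which `f` is
obtained by repeatedly deleting the zeros and decreasing the other entries. -/
def Desc (f : List ℕ) (M : ℕ) : Set (List ℕ) :=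
  {e | Good e ∧ slack e = 0 ∧ dist e = M ∧ ∃ t, down^[t] e = f}

theorem dist_add_slack_of_mem_kids {f k : List ℕ} (hf : f ≠ []) (hk : k ∈ kids f) :
    dist f ≤ dist k ∧ dist f + slack f ≤ dist k + slack k ∧
      (dist f < dist k ∨ dist f + slack f < dist k + slack k) := by
  rcases mem_kids.1 hk with rfl | ⟨p, hp, rfl⟩ | ⟨q, hq, p, hp, hpq, rfl⟩
  · rw [dist_up, slack_up hf]; omega
  · rw [dist_ins_up, slack_ins_up hf hp]; split_ifs <;> omega
  · rw [dist_ins_ins_up, slack_ins_ins_up hf hp hq hpq]; split_ifs <;> omega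

theorem dist_add_slack_le_of_mem_desc {f e : List ℕ} {M : ℕ} (hf : f ≠ []) (he : e ∈ Desc f M) :
    dist f + slack f ≤ M := by
  obtain ⟨hg, hs, rfl, t, rfl⟩ := he
  suffices h : dist (down^[t] e) + slack (down^[t] e) ≤ dist e + slack e by omega
  clear hs
  induction t generalizing e with
  | zero => exact le_rfl
  | succ t ih =>
    rw [Function.iterate_succ_apply] at hf ⊢
    have hd : down e ≠ [] := by
      intro h
      rw [h, iterate_down_nil] at hf
      exact hf rfl
    exact (ih (good_down hg) hf).trans (dist_add_slack_of_mem_kids hd (mem_kids_down hg)).2.1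

theorem mem_desc_iff {f e : List ℕ} {M : ℕ} (hf : Good f) :
    e ∈ Desc f M ↔ (e = f ∧ slack f = 0 ∧ dist f = M) ∨ ∃ k ∈ kids f, e ∈ Desc k M := by
  constructor
  · rintro ⟨hg, hs, hd, t, ht⟩
    rcases t with _ | t
    · obtain rfl : e = f := ht
      exact Or.inl ⟨rfl, hs, hd⟩
    · rw [Function.iterate_succ_apply'] at ht
      exact Or.inr ⟨down^[t] e, ht ▸ mem_kids_down (good_iterate_down hg t), hg, hs, hd, t, rfl⟩
  · rintro (⟨rfl, hs, hd⟩ | ⟨k, hk, hg, hs, hd, t, ht⟩)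
    · exact ⟨hf, hs, hd, 0, rfl⟩
    · refine ⟨hg, hs, hd, t + 1, ?_⟩
      rw [Function.iterate_succ_apply', ht, down_of_mem_kids hk]

/-- Carries finiteness along with the count. Nonemptiness of `f` is essential, since the empty word
is its own child. -/
theorem exists_finset_desc {b : PowerSeries ℚ} (hb : b = 1 + X * b ^ 4) (M : ℕ) {f : List ℕ}
    (hf : f ≠ []) (hg : Good f) : ∃ F : Finset (List ℕ), (∀ e, e ∈ F ↔ e ∈ Desc f M) ∧
      (F.card : ℚ) = coeff M (weight b f) := by
  -- For a child neither difference grows and one shrinks, as long as `dist f + slack f ≤ M`; beyond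
  -- that bound both the set and the coefficient vanish.
  induction hN : (M + 1 - (dist f + slack f)) + (M + 1 - dist f) using Nat.strong_induction_on
    generalizing f with
  | _ N ih =>
  by_cases hM : dist f + slack f ≤ M
  · have key : ∀ k ∈ kids f, ∃ F : Finset (List ℕ), (∀ e, e ∈ F ↔ e ∈ Desc k M) ∧
        (F.card : ℚ) = coeff M (weight b k) := by
      intro k hk
      have := dist_add_slack_of_mem_kids hf hk
      exact ih _ (by omega) (ne_nil_of_mem_kids hf hk) (good_of_mem_kids hg hk) rfl
    choose! F hF hc using key
    -- A common descendant would reach `f` after a unique number of steps, so its ancestor one step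
    -- earlier is unique too.
    have hdisj : ∀ k ∈ kids f, ∀ k' ∈ kids f, k ≠ k' → Disjoint (F k) (F k') := by
      intro k hk k' hk' hne
      rw [Finset.disjoint_left]
      intro e he he'
      obtain ⟨-, -, -, t, ht⟩ := (hF k hk e).1 he
      obtain ⟨-, -, -, t', ht'⟩ := (hF k' hk' e).1 he'
      have h1 : down^[t + 1] e = f := by
        rw [Function.iterate_succ_apply', ht, down_of_mem_kids hk]
      have h2 : down^[t' + 1] e = f := by
        rw [Function.iterate_succ_apply', ht', down_of_mem_kids hk']
      have := iterate_down_injective hf h1 h2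
      obtain rfl : t = t' := by omega
      exact hne (ht.symm.trans ht')
    have hself : ∀ k ∈ kids f, f ∉ F k := by
      intro k hk h
      obtain ⟨-, -, -, t, ht⟩ := (hF k hk f).1 h
      refine iterate_down_ne_self hf t ?_
      rw [Function.iterate_succ_apply', ht, down_of_mem_kids hk]
    refine ⟨(if slack f = 0 ∧ dist f = M then {f} else ∅) ∪ (kids f).biUnion F, fun e => ?_, ?_⟩
    · rw [mem_desc_iff hg, Finset.mem_union, Finset.mem_biUnion]
      refine or_congr ?_ (exists_congr fun k => and_congr_right fun hk => hF k hk e)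
      split_ifs with h
      · simp [h]
      · simp [h]
    · rw [Finset.card_union_of_disjoint, Finset.card_biUnion hdisj, weight_eq_sum_kids hb hf,
        map_add, map_sum, Nat.cast_add, Nat.cast_sum, Finset.sum_congr rfl hc]
      · congr 1
        by_cases h0 : slack f = 0
        · by_cases h1 : dist f = M
          · simp [h0, h1, coeff_X_pow]
          · simp [h0, h1, coeff_X_pow, Ne.symm h1]
        · simp [h0]
      · rw [Finset.disjoint_left]
        intro e he he'
        obtain ⟨k, hk, hek⟩ := Finset.mem_biUnion.1 he'
        split_ifs at he with h
        · rw [Finset.mem_singleton] at he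
          exact hself k hk (he ▸ hek)
        · simp at he
  · refine ⟨∅, fun e => ?_, ?_⟩
    · simp only [Finset.notMem_empty, false_iff]
      exact fun he => hM (dist_add_slack_le_of_mem_desc hf he)
    · rw [weight, coeff_X_pow_mul', if_neg hM, Finset.card_empty, Nat.cast_zero]

/-! ### The roots `[0]` and `[0, 0]` and the total count -/

theorem good_replicate_zero {n : ℕ} (hn : n ≤ 2) : Good (List.replicate n 0) := by
  refine ⟨fun a b c h hba => ?_, fun a => ?_⟩
  · have := List.eq_of_mem_replicate (h.subset (show a ∈ [a, b, c] by simp))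
    omega
  · rw [List.count_replicate]
    split_ifs <;> omega

theorem eq_replicate_of_down_eq_nil {e : List ℕ} (h : down e = []) :
    e = List.replicate e.length 0 := by
  induction e with
  | nil => rfl
  | cons a u ih =>
    cases a with
    | zero => rw [List.length_cons, List.replicate_succ, ← ih h]
    | succ n => simp [down] at h

/-- The last nonempty iterate of `down` consists of zeros only, at most two of them. -/
theorem exists_iterate_down_eq {e : List ℕ} (he : e ≠ []) (hg : Good e) :
    (∃ t, down^[t] e = [0]) ∨ ∃ t, down^[t] e = [0, 0] := by
  induction hN : (up e).sum using Nat.strong_induction_on generalizing e with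
  | _ N ih =>
  by_cases hd : down e = []
  · have h1 := eq_replicate_of_down_eq_nil hd
    have h2 := hg.2 0
    have h3 := List.length_pos_iff.2 he
    rw [h1, List.count_replicate_self] at h2
    rcases (by omega : e.length = 1 ∨ e.length = 2) with h | h
    · rw [h] at h1; exact Or.inl ⟨0, h1⟩
    · rw [h] at h1; exact Or.inr ⟨0, h1⟩
  · have h1 := sum_up_down_add_length_le e
    have h2 := List.length_pos_iff.2 he
    rcases ih _ (by omega) hd (good_down hg) rfl with ⟨t, ht⟩ | ⟨t, ht⟩
    · exact Or.inl ⟨t + 1, ht⟩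
    · exact Or.inr ⟨t + 1, ht⟩

theorem sites_zero : sites [0] = {0, 1} := by decide

theorem sites_zero_zero : sites [0, 0] = {0, 1, 2} := by decide

theorem ncard_good {b : PowerSeries ℚ} (hb : b = 1 + X * b ^ 4) (M : ℕ) :
    (({e | Good e ∧ slack e = 0 ∧ dist e = M} : Set (List ℕ)).ncard : ℚ) = coeff M (b ^ 2) := by
  obtain ⟨F, hF, hFc⟩ := exists_finset_desc hb M (f := [0]) (by simp)
    (good_replicate_zero (n := 1) (by omega))
  obtain ⟨G, hG, hGc⟩ := exists_finset_desc hb M (f := [0, 0]) (by simp)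
    (good_replicate_zero (n := 2) (by omega))
  have hw1 : weight b [0] = X * b ^ 4 := by
    rw [weight, sites_zero]
    simp [dist, slack]
  have hw2 : weight b [0, 0] = X * b ^ 5 := by
    rw [weight, sites_zero_zero]
    simp [dist, slack]
  have hFG : Disjoint F G := by
    rw [Finset.disjoint_left]
    intro e he he'
    obtain ⟨-, -, -, t, ht⟩ := (hF e).1 he
    obtain ⟨-, -, -, t', ht'⟩ := (hG e).1 he'
    rcases lt_trichotomy t t' with h | rfl | h
    · obtain ⟨n, rfl⟩ := Nat.exists_eq_add_of_lt h
      rw [show t + n + 1 = n + 1 + t by ring, Function.iterate_add_apply, ht,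
        Function.iterate_succ_apply, show down [0] = [] from rfl, iterate_down_nil] at ht'
      simp at ht'
    · rw [ht] at ht'
      simp at ht'
    · obtain ⟨n, rfl⟩ := Nat.exists_eq_add_of_lt h
      rw [show t' + n + 1 = n + 1 + t' by ring, Function.iterate_add_apply, ht',
        Function.iterate_succ_apply, show down [0, 0] = [] from rfl, iterate_down_nil] at ht
      simp at ht
  have hnil : Disjoint (if M = 0 then ({[]} : Finset (List ℕ)) else ∅) (F ∪ G) := by
    rw [Finset.disjoint_left]
    intro e he he'
    split_ifs at he with h
    · obtain rfl := Finset.mem_singleton.1 he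
      rcases Finset.mem_union.1 he' with he' | he'
      · obtain ⟨-, -, -, t, ht⟩ := (hF _).1 he'
        rw [iterate_down_nil] at ht
        simp at ht
      · obtain ⟨-, -, -, t, ht⟩ := (hG _).1 he'
        rw [iterate_down_nil] at ht
        simp at ht
    · simp at he
  have hset : ({e | Good e ∧ slack e = 0 ∧ dist e = M} : Set (List ℕ)) =
      ↑((if M = 0 then ({[]} : Finset (List ℕ)) else ∅) ∪ (F ∪ G)) := by
    ext e
    rw [Finset.mem_coe, Finset.mem_union, Finset.mem_union, hF, hG]
    constructor
    · rintro ⟨hg, hs, hd⟩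
      by_cases he : e = []
      · subst he
        have : M = 0 := hd.symm
        simp [this]
      · rcases exists_iterate_down_eq he hg with h | h
        · exact Or.inr (Or.inl ⟨hg, hs, hd, h⟩)
        · exact Or.inr (Or.inr ⟨hg, hs, hd, h⟩)
    · rintro (h | ⟨hg, hs, hd, -⟩ | ⟨hg, hs, hd, -⟩)
      · split_ifs at h with h0
        · obtain rfl := Finset.mem_singleton.1 h
          exact ⟨good_replicate_zero (n := 0) (by omega), rfl, h0.symm⟩
        · simp at h
      · exact ⟨hg, hs, hd⟩
      · exact ⟨hg, hs, hd⟩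
  have hb2 : b ^ 2 = 1 + (X * b ^ 4 + X * b ^ 5) := by linear_combination (b + 1) * hb
  rw [hset, Set.ncard_coe_finset, Finset.card_union_of_disjoint hnil,
    Finset.card_union_of_disjoint hFG, hb2, map_add, map_add, ← hw1, ← hw2, ← hFc, ← hGc, coeff_one]
  split_ifs <;> simp

/-! ### Patterns -/

/-- Recovers the order of two letters from the order of their reduced values. -/
theorem lt_of_card_filter_lt {s : Finset ℕ} {a b : ℕ}
    (h : (s.filter (· < a)).card < (s.filter (· < b)).card) : a < b := by
  by_contra hab
  refine absurd (Finset.card_le_card fun x hx => ?_) (not_le.2 h)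
  rw [Finset.mem_filter] at hx ⊢
  exact ⟨hx.1, hx.2.trans_le (not_lt.1 hab)⟩

theorem contains_102_iff (e : List ℕ) :
    Contains e [1, 0, 2] ↔ ∃ a b c, [a, b, c].Sublist e ∧ b < a ∧ a < c := by
  constructor
  · rintro ⟨s, hs, hr⟩
    obtain ⟨a, b, c, rfl⟩ := List.length_eq_three.1
      (show s.length = 3 by simpa [reduction] using congrArg List.length hr)
    refine ⟨a, b, c, hs, ?_⟩
    simp only [reduction, List.map_cons, List.map_nil, List.cons.injEq] at hr
    exact ⟨lt_of_card_filter_lt (s := [a, b, c].toFinset) (by omega),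
      lt_of_card_filter_lt (s := [a, b, c].toFinset) (by omega)⟩
  · rintro ⟨a, b, c, hs, hba, hac⟩
    refine ⟨_, hs, ?_⟩
    have ha : [a, b, c].toFinset.filter (· < a) = {b} := by ext x; simp; omega
    have hb : [a, b, c].toFinset.filter (· < b) = ∅ := by ext x; simp; omega
    have hc : [a, b, c].toFinset.filter (· < c) = {a, b} := by ext x; simp; omega
    rw [reduction, List.map_cons, List.map_cons, List.map_cons, ha, hb, hc,
      Finset.card_pair hba.ne']
    rfl

theorem contains_000_iff (e : List ℕ) : Contains e [0, 0, 0] ↔ ∃ a, 2 < e.count a := by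
  constructor
  · rintro ⟨s, hs, hr⟩
    obtain ⟨a, b, c, rfl⟩ := List.length_eq_three.1
      (show s.length = 3 by simpa [reduction] using congrArg List.length hr)
    simp only [reduction, List.map_cons, List.map_nil, List.cons.injEq, Finset.card_eq_zero,
      Finset.filter_eq_empty_iff, List.mem_toFinset, List.mem_cons, not_lt] at hr
    obtain ⟨ha, hb, hc, -⟩ := hr
    obtain rfl : a = b := le_antisymm (ha (by simp)) (hb (by simp))
    obtain rfl : a = c := le_antisymm (ha (by simp)) (hc (by simp))
    exact ⟨a, by simpa [Nat.succ_le_iff] using hs.count_le a⟩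
  · rintro ⟨a, ha⟩
    refine ⟨List.replicate 3 a, List.replicate_sublist_iff.2 ha, ?_⟩
    simp [reduction, List.replicate]

theorem avoids_iff_good (e : List ℕ) :
    (∀ w ∈ [[1, 0, 2], [0, 0, 0]], Avoids e w) ↔ Good e := by
  simp only [List.forall_mem_cons, Avoids, contains_102_iff, contains_000_iff, Good, not_exists,
    not_and, not_lt]
  simp

theorem mem_ISdist_iff (e : List ℕ) (n m : ℕ) : e ∈ ISdist n m [[1, 0, 2], [0, 0, 0]] ↔
    e.length = n ∧ Good e ∧ slack e = 0 ∧ dist e = m := by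
  simp only [ISdist, IS, Set.mem_ofPred_eq, avoids_iff_good, isInversionSeq_iff]
  tauto

theorem length_mem_Icc_of_good {e : List ℕ} (he : Good e) :
    e.length ∈ Set.Icc (dist e) (2 * dist e) := by
  refine ⟨List.toFinset_card_le e, ?_⟩
  rw [← List.sum_toFinset_count_eq_length, mul_comm, dist, ← smul_eq_mul]
  exact Finset.sum_le_card_nsmul _ _ _ fun a _ => he.2 a

theorem setOf_exists_mem_ISdist (m : ℕ) :
    {e : List ℕ | ∃ n : ℕ, e ∈ ISdist n m [[1, 0, 2], [0, 0, 0]]} =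
      {e | Good e ∧ slack e = 0 ∧ dist e = m} := by
  ext e
  simp [mem_ISdist_iff]

theorem iUnion_ISdist (m : ℕ) :
    (⋃ n ∈ Set.Icc m (2 * m), ISdist n m [[1, 0, 2], [0, 0, 0]]) =
      {e | Good e ∧ slack e = 0 ∧ dist e = m} := by
  ext e
  simp only [Set.mem_iUnion, mem_ISdist_iff, Set.mem_ofPred_eq, exists_prop]
  constructor
  · rintro ⟨n, -, -, h⟩
    exact h
  · rintro ⟨hg, hs, rfl⟩
    exact ⟨e.length, length_mem_Icc_of_good hg, rfl, hg, hs, rfl⟩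

theorem ncard_iUnion_ISdist {b : PowerSeries ℚ} (hb : b = 1 + X * b ^ 4) (m : ℕ) :
    (((⋃ n ∈ Set.Icc m (2 * m), ISdist n m [[1, 0, 2], [0, 0, 0]]).ncard : ℕ) : ℚ) =
      coeff m (b ^ 2) := by
  rw [iUnion_ISdist, ncard_good hb]

end InvSeq

theorem mainTheorem5 :
    -- the sequences with `m` distinct elements, of any length, are those of length `m ≤ n ≤ 2m`,
    -- and there are `C(4m+2, m) / (2m+1)` of them
    (∀ m : ℕ,
      {e : List ℕ | ∃ n : ℕ, e ∈ InvSeq.ISdist n m [[1, 0, 2], [0, 0, 0]]} =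
        (⋃ n ∈ Set.Icc m (2 * m), InvSeq.ISdist n m [[1, 0, 2], [0, 0, 0]]) ∧
      (((⋃ n ∈ Set.Icc m (2 * m), InvSeq.ISdist n m [[1, 0, 2], [0, 0, 0]]).ncard : ℕ) : ℚ) =
        1 / (2 * (m : ℚ) + 1) * ((4 * m + 2).choose m : ℚ)) ∧
    -- the generating function of these numbers is `b ^ 2`, where `b = 1 + y * b ^ 4`
    (∃! b : PowerSeries ℚ, b = 1 + PowerSeries.X * b ^ 4) ∧
    (∀ b : PowerSeries ℚ, b = 1 + PowerSeries.X * b ^ 4 →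
      PowerSeries.mk (fun m : ℕ =>
        (((⋃ n ∈ Set.Icc m (2 * m),
          InvSeq.ISdist n m [[1, 0, 2], [0, 0, 0]]).ncard : ℕ) : ℚ)) = b ^ 2) := by
  -- `raneySeries 1` gives both the existence of `b` and, through its square `raneySeries 2`, the
  -- closed formula.
  have hb := InvSeq.raneySeries_one_eq
  refine ⟨fun m => ⟨?_, ?_⟩, ?_, fun b hb' => ?_⟩
  · rw [InvSeq.setOf_exists_mem_ISdist, InvSeq.iUnion_ISdist]
  · rw [InvSeq.ncard_iUnion_ISdist hb, ← InvSeq.raneySeries_eq_pow, InvSeq.raneySeries,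
      PowerSeries.coeff_mk, InvSeq.raney_eq m 1]
    have h : (2 * (m : ℚ) + 1) ≠ 0 := by positivity
    have h' : (4 * (m : ℚ) + (1 + 1)) ≠ 0 := by positivity
    push_cast
    field_simp
    ring
  · exact ⟨_, hb, fun c hc => InvSeq.eq_of_eq_one_add_X_mul_pow_four hc hb⟩
  · ext m
    rw [PowerSeries.coeff_mk, InvSeq.ncard_iUnion_ISdist hb']
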